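/- Let $N\ge 2$. An $N$-partite state is a density operator $\rho\in\mathcal B((\mathbb C^d)^{\otimes N})$ (positive semidefinite, of trace one), for some local dimension $d$. A $K$-partition $S$ is a partition of the $N$ parties into $K$ pairwise disjoint nonempty groups $S_1,\dots,S_K$. The state $\rho$ is $K$-separable if $$\rho=\sum_{S}p_S\sum_i q_S^i\bigotimes_{k=1}^K|\psi_{S_k}^i\rangle\langle\psi_{S_k}^i|,$$ a finite sum over $K$-partitions $S$ and indices $i$, where $(p_S)_S$ and, for each $S$, $(q^i_S)_i$ are probability distributions and $|\psi_{S_k}^i\rangle$ are pure states of the parties in $S_k$. It is genuinely multipartite entangled if it is not $K$-separable for any $K\ge2$ (in particular, it is not biseparable). A generalized measurement (POVM) on $\mathbb C^d$ is a finite family of positive semidefinite operators on $\mathbb C^d$ that sum to the identity. The state $\rho$ is $K$-local (for generalized measurements) if there are a measurable space of values $\lambda$, a probability distribution $(p_S)_S$ on the $K$-partitions, probability measures $\omega_S$ on the space of $\lambda$, and response functions $p_{S_k}(\cdot\,|\,\mathsf M_{S_k},\lambda)$ such that for all generalized measurements $\mathsf M=(M_1,\dots,M_N)$ of the parties and all outcomes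 $\mathsf a=(a_1,\dots,a_N)$ $$\operatorname{Tr}\big[(M^{(1)}_{a_1}\otimes\dots\otimes M^{(N)}_{a_N})\,\rho\big]=\sum_{S}p_S\int \mathrm d\omega_S(\lambda)\prod_{k=1}^K p_{S_k}(\mathsf a_{S_k}|\mathsf M_{S_k},\lambda).$$ Here the sum is over all $K$-partitions; $p_S$, $\omega_S$ and the response functions do not depend on the choice of $\mathsf M$; and for every choice $\mathsf M_{S_k}$ of the measurements of the parties in $S_k$ and every $\lambda$, $p_{S_k}(\cdot\,|\,\mathsf M_{S_k},\lambda)$ is a probability distribution on the outcomes $\mathsf a_{S_k}$ of these measurements, measurable in $\lambda$. The state is bilocal if it is $2$-local, and genuinely multipartite nonlocal if it is not bilocal. **Theorem.** For every number of parties $N\ge2$ there exists a genuinely multipartite entangled $N$-partite state that has a bilocal model for generalized measurements. Hence genuine multipartite entanglement and genuine multipartite nonlocality are inequivalent for every $N\geq 2$. -/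

import Mathlib

open scoped BigOperators ComplexOrder

namespace MultipartiteLocality

/-- Operators on the `N`-partite Hilbert space `(ℂ^d)^{⊗ N}`, written as matrices in the product
basis, whose elements are labelled by the multi-indices `x : Fin N → Fin d`. -/
abbrev Operator (N d : ℕ) : Type :=
  Matrix (Fin N → Fin d) (Fin N → Fin d) ℂ

/-- An `N`-partite quantum state (density matrix) with local dimension `d`. -/
def IsState {N d : ℕ} (ρ : Operator N d) : Prop :=
  ρ.PosSemidef ∧ ρ.trace = 1

/-- The `K`-partitions of the `N` parties: partitions of the set of parties into `K` pairwise
disjoint nonempty groups. -/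
def kPartitions (N K : ℕ) :
    Finset (Finpartition (Finset.univ : Finset (Fin N))) :=
  Finset.univ.filter fun P => P.parts.card = K

/-- Vectors of the Hilbert space `⨂_{i ∈ B} ℂ^d` of the group `B` of parties, in the product
basis. -/
abbrev GroupVector {N : ℕ} (d : ℕ) (B : Finset (Fin N)) : Type :=
  (B → Fin d) → ℂ

/-- Pure states are the vectors of norm one. -/
def IsPureState {N d : ℕ} {B : Finset (Fin N)} (ψ : GroupVector d B) : Prop :=
  ∑ x, ‖ψ x‖ ^ 2 = 1

/-- The product vector `⨂_{B ∈ P} ψ_B` in the `N`-partite Hilbert space, for a partition `P` of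
the parties. -/
def productVector {N d : ℕ} (P : Finpartition (Finset.univ : Finset (Fin N)))
    (ψ : (B : Finset (Fin N)) → GroupVector d B) : (Fin N → Fin d) → ℂ :=
  fun x => ∏ B ∈ P.parts, ψ B (fun i => x i)

/-- The rank-one operator `|Ψ⟩⟨Ψ|`. -/
def ketBra {N d : ℕ} (Ψ : (Fin N → Fin d) → ℂ) : Operator N d :=
  Matrix.vecMulVec Ψ (star Ψ)

/-- `K`-separability: `ρ = ∑_S p_S ∑_i q_S^i ⨂_k |ψ_{S_k}^i⟩⟨ψ_{S_k}^i|`, a probabilistic mixture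
of states each of which is separable with respect to some `K`-partition `S`. -/
def IsKSeparable {N d : ℕ} (K : ℕ) (ρ : Operator N d) : Prop :=
  ∃ (n : ℕ) (p : Finpartition (Finset.univ : Finset (Fin N)) → ℝ)
    (q : Finpartition (Finset.univ : Finset (Fin N)) → Fin n → ℝ)
    (ψ : Finpartition (Finset.univ : Finset (Fin N)) → Fin n →
      (B : Finset (Fin N)) → GroupVector d B),
    (∀ S ∈ kPartitions N K, 0 ≤ p S) ∧
    (∑ S ∈ kPartitions N K, p S = 1) ∧
    (∀ S ∈ kPartitions N K, (∀ i, 0 ≤ q S i) ∧ ∑ i, q S i = 1) ∧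
    (∀ S ∈ kPartitions N K, ∀ i, ∀ B ∈ S.parts, IsPureState (ψ S i B)) ∧
    ρ = ∑ S ∈ kPartitions N K, (p S : ℂ) •
          ∑ i, (q S i : ℂ) • ketBra (productVector S (ψ S i))

/-- Genuine multipartite entanglement: no form of `K`-separability with `K ≥ 2`. -/
def IsGME {N d : ℕ} (ρ : Operator N d) : Prop :=
  ∀ K : ℕ, 2 ≤ K → ¬ IsKSeparable K ρ

/-- A generalized measurement (POVM) on `ℂ^d` with finitely many outcomes. -/
structure POVM (d : ℕ) where
  numOutcomes : ℕ
  effect : Fin numOutcomes → Matrix (Fin d) (Fin d) ℂ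
  posSemidef : ∀ a, (effect a).PosSemidef
  sum_effect : ∑ a, effect a = 1

/-- The set of outcomes of a measurement. -/
abbrev POVM.Outcome {d : ℕ} (M : POVM d) : Type := Fin M.numOutcomes

/-- The product operator `M^{(1)}_{a_1} ⊗ ⋯ ⊗ M^{(N)}_{a_N}`. -/
def productEffect {N d : ℕ} (M : Fin N → POVM d) (a : (i : Fin N) → (M i).Outcome) :
    Operator N d :=
  Matrix.of fun x y => ∏ i, (M i).effect (a i) (x i) (y i)

/-- The Born rule `p(a | M) = Tr[(M^{(1)}_{a_1} ⊗ ⋯ ⊗ M^{(N)}_{a_N}) ρ]`. -/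
noncomputable def bornProb {N d : ℕ} (ρ : Operator N d) (M : Fin N → POVM d)
    (a : (i : Fin N) → (M i).Outcome) : ℂ :=
  (productEffect M a * ρ).trace

/-- A `K`-local hidden-variable model for the generalized measurements on `ρ`:
`p(a | M) = ∑_S p_S ∫ dλ ω_S(λ) ∏_k p_k(a_{S_k} | M_{S_k}, λ)` for all local measurements `M` and
outcomes `a`. The weights, the distributions of `λ` and the response functions are fixed before
the measurements, and the response function of a group sees the measurements and the outcomes of
that group only. -/
structure KLocalModel {N d : ℕ} (K : ℕ) (ρ : Operator N d) where
  /-- the values of the classical information -/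
  Hidden : Type
  [measurableSpace : MeasurableSpace Hidden]
  /-- the probabilities `p_S` of the `K`-partitions -/
  weight : Finpartition (Finset.univ : Finset (Fin N)) → ℝ
  weight_nonneg : ∀ S ∈ kPartitions N K, 0 ≤ weight S
  sum_weight : ∑ S ∈ kPartitions N K, weight S = 1
  /-- the distributions `ω_S` -/
  ω : Finpartition (Finset.univ : Finset (Fin N)) → MeasureTheory.Measure Hidden
  isProbabilityMeasure : ∀ S ∈ kPartitions N K, MeasureTheory.IsProbabilityMeasure (ω S)
  /-- the response functions `p_B(a_B | M_B, λ)` of the groups `B` of the partition `S` -/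
  response : Finpartition (Finset.univ : Finset (Fin N)) → (B : Finset (Fin N)) →
    (M : B → POVM d) → ((i : B) → (M i).Outcome) → Hidden → ℝ
  response_measurable : ∀ S ∈ kPartitions N K, ∀ B ∈ S.parts, ∀ (M : B → POVM d) a,
    Measurable (response S B M a)
  response_nonneg : ∀ S ∈ kPartitions N K, ∀ B ∈ S.parts, ∀ (M : B → POVM d) a l,
    0 ≤ response S B M a l
  sum_response : ∀ S ∈ kPartitions N K, ∀ B ∈ S.parts, ∀ (M : B → POVM d) l,
    ∑ a, response S B M a l = 1
  bornProb_eq : ∀ (M : Fin N → POVM d) (a : (i : Fin N) → (M i).Outcome),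
    bornProb ρ M a =
      ((∑ S ∈ kPartitions N K, weight S *
        ∫ l, ∏ B ∈ S.parts, response S B (fun i => M i) (fun i => a i) l ∂(ω S) : ℝ) : ℂ)

/-- A state is `K`-local (for generalized measurements) if it has a `K`-local model. -/
def IsKLocal {N d : ℕ} (K : ℕ) (ρ : Operator N d) : Prop :=
  Nonempty (KLocalModel K ρ)

/-- Bilocality is `2`-locality. -/
def IsBilocal {N d : ℕ} (ρ : Operator N d) : Prop :=
  IsKLocal 2 ρ

/-- Genuine multipartite nonlocality: there is no bilocal model. -/
def IsGMN {N d : ℕ} (ρ : Operator N d) : Prop :=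
  ¬ IsBilocal ρ

end MultipartiteLocality

/-!
The state is the two-qubit isotropic state of visibility `η = 11 / 30`, with the basis vectors of one
qubit copied to the parties in a group `A` and those of the other to the parties in `Aᶜ`. In other
words it is the mixture `η |GHZ⟩⟨GHZ| + (1 - η) / 4 ∑ i j, |i_A j_{Aᶜ}⟩⟨i_A j_{Aᶜ}|`.

*Entanglement.* A vector that is a product over a partition with at least two groups has squared
overlap at most `1 / 2` with the normalized GHZ vector (`norm_productVector_add_le_one`), and hence
so has every `K`-separable state with `K ≥ 2`. The state above has `(1 + 3 η) / 4`, which exceeds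
`1 / 2` because `η > 1 / 3`.

*Bilocality.* A product measurement of a group acts on its copied qubit as a qubit measurement, whose
effects are entrywise products of the effects of the parties (`groupEffect`) and are positive by the
Schur product theorem. So a local model of the isotropic state suffices. In the model the hidden
variable is a Bloch vector `n`. The group `Aᶜ` answers as the pure state `n` would. The group `A`
answers `k` with a probability `biasedResponse (E k) n` of at most `⟨n|E k|n⟩`, and assigns what is
missing from one to the outcomes in proportion to the traces of the effects (`completedResponse`).
For a multiple of a projector with `p = ⟨n|E|n⟩` and complementary probability `p'`, the response
`p` itself would give visibility `1 / 3`, just the separable range. Damping it to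
`p * (1 - (p' / tr E) ^ 2)` favours Bloch vectors aligned with the effect and raises the visibility
to `11 / 30`. Since this response is a cubic polynomial in `n`, the average over the sphere can be
taken over a spherical design, so that the hidden variable has only fourteen values
(`sum_designWeight_mul_harmonics`).
-/

namespace MultipartiteLocality

/-! ### Qubit effects in Bloch form -/

/-- The coefficient of the identity in the Bloch form `t • 1 + m · σ` of a qubit effect. -/
noncomputable def blochScalar (E : Matrix (Fin 2) (Fin 2) ℂ) : ℝ :=
  ((E 0 0).re + (E 1 1).re) / 2

/-- The vector `m` in the Bloch form `t • 1 + m · σ` of a qubit effect. The second coordinate has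
the sign opposite to that of the usual Pauli matrix `σ_y`. -/
noncomputable def blochVector (E : Matrix (Fin 2) (Fin 2) ℂ) : Fin 3 → ℝ :=
  ![(E 0 1).re, (E 0 1).im, ((E 0 0).re - (E 1 1).re) / 2]

/-- The probability `⟨n|E|n⟩` of the effect `E` in the pure qubit state with Bloch vector `n`, which
is expressed in the coordinates of `blochVector`. -/
noncomputable def qubitProb (E : Matrix (Fin 2) (Fin 2) ℂ) (n : Fin 3 → ℝ) : ℝ :=
  blochScalar E + blochVector E ⬝ᵥ n

section Bloch

variable {κ : Type*} [Fintype κ] {E : κ → Matrix (Fin 2) (Fin 2) ℂ}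

lemma sum_blochScalar (hE : ∑ k, E k = 1) : ∑ k, blochScalar (E k) = 1 := by
  have h0 := congrArg Complex.re (congrFun (congrFun hE 0) 0)
  have h1 := congrArg Complex.re (congrFun (congrFun hE 1) 1)
  simp only [Matrix.sum_apply, Complex.re_sum, Matrix.one_apply_eq, Complex.one_re] at h0 h1
  simp only [blochScalar, ← Finset.sum_div, Finset.sum_add_distrib, h0, h1]
  norm_num

lemma sum_blochVector (hE : ∑ k, E k = 1) : ∑ k, blochVector (E k) = 0 := by
  have h0 := congrArg Complex.re (congrFun (congrFun hE 0) 0)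
  have h1 := congrArg Complex.re (congrFun (congrFun hE 1) 1)
  have h2 := congrArg Complex.re (congrFun (congrFun hE 0) 1)
  have h3 := congrArg Complex.im (congrFun (congrFun hE 0) 1)
  simp [Matrix.sum_apply] at h0 h1 h2 h3
  ext j
  fin_cases j
  · simpa [blochVector] using h2
  · simpa [blochVector] using h3
  · simp [blochVector, ← Finset.sum_div, h0, h1]

lemma sum_qubitProb (hE : ∑ k, E k = 1) (n : Fin 3 → ℝ) : ∑ k, qubitProb (E k) n = 1 := by
  simp only [qubitProb, Finset.sum_add_distrib, sum_blochScalar hE, ← sum_dotProduct,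
    sum_blochVector hE, zero_dotProduct, add_zero]

end Bloch

section Positivity

variable {E : Matrix (Fin 2) (Fin 2) ℂ}

lemma apply_one_zero_eq (hE : E.PosSemidef) : E 1 0 = star (E 0 1) :=
  (hE.isHermitian.apply 1 0).symm

lemma im_apply_self_eq_zero (hE : E.PosSemidef) (i : Fin 2) : (E i i).im = 0 :=
  ((Complex.nonneg_iff.1 (hE.diag_nonneg (i := i))).2).symm

lemma blochScalar_nonneg (hE : E.PosSemidef) : 0 ≤ blochScalar E := by
  have h0 := (Complex.nonneg_iff.1 (hE.diag_nonneg (i := 0))).1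
  have h1 := (Complex.nonneg_iff.1 (hE.diag_nonneg (i := 1))).1
  unfold blochScalar
  positivity

/-- The difference of the two sides is the determinant of `E`. -/
lemma blochVector_dotProduct_self_le (hE : E.PosSemidef) :
    blochVector E ⬝ᵥ blochVector E ≤ blochScalar E ^ 2 := by
  have h := (Complex.nonneg_iff.1 hE.det_nonneg).1
  rw [Matrix.det_fin_two, apply_one_zero_eq hE] at h
  simp [im_apply_self_eq_zero hE] at h
  simp [blochVector, blochScalar, dotProduct, Fin.sum_univ_three]
  nlinarith

lemma sq_dotProduct_le (m : Fin 3 → ℝ) {n : Fin 3 → ℝ} (hn : n ⬝ᵥ n = 1) :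
    (m ⬝ᵥ n) ^ 2 ≤ m ⬝ᵥ m := by
  have h := Finset.sum_mul_sq_le_sq_mul_sq Finset.univ m n
  simp only [dotProduct] at hn ⊢
  simpa only [pow_two, hn, mul_one] using h

lemma qubitProb_nonneg (hE : E.PosSemidef) {n : Fin 3 → ℝ} (hn : n ⬝ᵥ n = 1) :
    0 ≤ qubitProb E n := by
  have h : |blochVector E ⬝ᵥ n| ≤ blochScalar E :=
    abs_le_of_sq_le_sq ((sq_dotProduct_le _ hn).trans (blochVector_dotProduct_self_le hE))
      (blochScalar_nonneg hE)
  unfold qubitProb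
  linarith [neg_abs_le (blochVector E ⬝ᵥ n)]

end Positivity

/-! ### The response of the first group -/

/-- For a multiple `E` of a projector, `p = ⟨n|E|n⟩` and `p' = tr E - p`, this is
`p * (1 - (p' / tr E) ^ 2)`. The remaining terms extend the expression to all effects so that
its parts of degree `0` and `1` in `n` are linear in `E`, and the rest is a sum of spherical
harmonics of degree `2` and `3`. At `E = 0`, where the denominators vanish, it is `0`. -/
noncomputable def biasedResponse (E : Matrix (Fin 2) (Fin 2) ℂ) (n : Fin 3 → ℝ) : ℝ :=
  5 / 6 * blochScalar E + 11 / 10 * (blochVector E ⬝ᵥ n)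
    + 1 / (12 * blochScalar E) *
      (3 * (blochVector E ⬝ᵥ n) ^ 2 - blochVector E ⬝ᵥ blochVector E)
    - 1 / (20 * blochScalar E ^ 2) * (5 * (blochVector E ⬝ᵥ n) ^ 3
      - 3 * (blochVector E ⬝ᵥ blochVector E) * (blochVector E ⬝ᵥ n))

/-- Normalized form of the bounds on `biasedResponse`: the expression is affine in `r`, so that the
extreme cases `r = u ^ 2` and `r = 1` suffice. -/
lemma biasedResponse_bounds_aux {u r : ℝ} (hu : u ^ 2 ≤ r) (hr : r ≤ 1) :
    0 ≤ 5 / 6 + 11 / 10 * u + (3 * u ^ 2 - r) / 12 - (5 * u ^ 3 - 3 * r * u) / 20 ∧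
    5 / 6 + 11 / 10 * u + (3 * u ^ 2 - r) / 12 - (5 * u ^ 3 - 3 * r * u) / 20 ≤ 1 + u := by
  have h1 : -1 ≤ u := by nlinarith
  have h2 : u ≤ 1 := by nlinarith
  set s := (1 - r) with hs
  have hr' : r = 1 - s := by rw [hs]; ring
  have hs0 : 0 ≤ s := by linarith
  have hs1 : s ≤ (1 - u) * (1 + u) := by nlinarith
  rw [hr']
  constructor
  · rcases le_total 0 (1 / 12 - 3 * u / 20) with h | h
    · -- The expression is `(3 - u) * (1 + u) ^ 2 / 4 + s * (1 / 12 - 3 * u / 20)`.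
      nlinarith [mul_nonneg hs0 h, mul_nonneg (by linarith : 0 ≤ 3 - u) (pow_two_nonneg (1 + u))]
    · have h3 := mul_nonneg (sub_nonneg.2 hs1) (neg_nonneg.2 h)
      have h4 : 0 ≤ (1 + u) * (5 / 6 + 4 / 15 * u - u ^ 2 / 10) :=
        mul_nonneg (by linarith) (by nlinarith)
      nlinarith
  · rcases le_total 0 (1 / 12 - 3 * u / 20) with h | h
    · have h3 := mul_nonneg (sub_nonneg.2 hs1) h
      have h4 : 0 ≤ (1 + u) * (1 - (5 / 6 + 4 / 15 * u - u ^ 2 / 10)) :=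
        mul_nonneg (by linarith) (by nlinarith)
      nlinarith
    · have h3 := mul_nonneg hs0 (neg_nonneg.2 h)
      have h4 : 0 ≤ (1 + u) * (1 - u) ^ 2 := mul_nonneg (by linarith) (sq_nonneg _)
      nlinarith

lemma biasedResponse_bounds {E : Matrix (Fin 2) (Fin 2) ℂ} (hE : E.PosSemidef)
    {n : Fin 3 → ℝ} (hn : n ⬝ᵥ n = 1) :
    0 ≤ biasedResponse E n ∧ biasedResponse E n ≤ qubitProb E n := by
  have hq := sq_dotProduct_le (blochVector E) hn
  have hm := blochVector_dotProduct_self_le hE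
  have ht := blochScalar_nonneg hE
  unfold biasedResponse qubitProb
  generalize blochVector E ⬝ᵥ n = q at *
  generalize blochVector E ⬝ᵥ blochVector E = R at *
  generalize blochScalar E = t at *
  rcases ht.eq_or_lt with rfl | ht
  · -- Positivity forces `E = 0`, and both sides of the upper bound are `0`.
    have : q = 0 := by nlinarith
    simp [this]
  · have h := biasedResponse_bounds_aux (u := q / t) (r := R / t ^ 2)
      (by rw [div_pow]; gcongr) (by rw [div_le_one (by positivity)]; exact hm)
    have e1 : 5 / 6 * t + 11 / 10 * q + 1 / (12 * t) * (3 * q ^ 2 - R)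
        - 1 / (20 * t ^ 2) * (5 * q ^ 3 - 3 * R * q) =
        t * (5 / 6 + 11 / 10 * (q / t) + (3 * (q / t) ^ 2 - R / t ^ 2) / 12
          - (5 * (q / t) ^ 3 - 3 * (R / t ^ 2) * (q / t)) / 20) := by
      field_simp
    have e2 : t + q = t * (1 + q / t) := by field_simp
    rw [e1, e2]
    exact ⟨mul_nonneg ht.le h.1, mul_le_mul_of_nonneg_left h.2 ht.le⟩

/-- The response of the first group to the qubit measurement `E`: the biased response, with the
missing probability distributed over the outcomes in proportion to the traces of the effects. -/
noncomputable def completedResponse {κ : Type*} [Fintype κ] (E : κ → Matrix (Fin 2) (Fin 2) ℂ)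
    (k : κ) (n : Fin 3 → ℝ) : ℝ :=
  biasedResponse (E k) n + blochScalar (E k) * (1 - ∑ l, biasedResponse (E l) n)

section Completed

variable {κ : Type*} [Fintype κ] {E : κ → Matrix (Fin 2) (Fin 2) ℂ}

lemma completedResponse_nonneg (hE : ∀ k, (E k).PosSemidef) (hE1 : ∑ k, E k = 1)
    {n : Fin 3 → ℝ} (hn : n ⬝ᵥ n = 1) (k : κ) : 0 ≤ completedResponse E k n := by
  have h : ∑ l, biasedResponse (E l) n ≤ 1 :=
    (Finset.sum_le_sum fun l _ => (biasedResponse_bounds (hE l) hn).2).trans_eq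
      (sum_qubitProb hE1 n)
  exact add_nonneg (biasedResponse_bounds (hE k) hn).1
    (mul_nonneg (blochScalar_nonneg (hE k)) (sub_nonneg.2 h))

lemma sum_completedResponse (hE1 : ∑ k, E k = 1) (n : Fin 3 → ℝ) :
    ∑ k, completedResponse E k n = 1 := by
  simp only [completedResponse, Finset.sum_add_distrib, ← Finset.sum_mul, sum_blochScalar hE1]
  ring

end Completed

/-! ### A spherical design -/

/-- Labels of the vertices of an octahedron and a cube with a common centre. -/
abbrev DesignIndex : Type := (Fin 3 × Bool) ⊕ (Bool × Bool × Bool)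

/-- The sign `±1` encoded by a Boolean. -/
def boolSign (b : Bool) : ℝ := if b then 1 else -1

/-- The vertices of the octahedron and of the cube on the unit sphere. -/
noncomputable def designPoint : DesignIndex → Fin 3 → ℝ
  | .inl (i, b) => Pi.single i (boolSign b)
  | .inr (a, b, c) => (√3)⁻¹ • ![boolSign a, boolSign b, boolSign c]

/-- The weights for which polynomials of degree at most five have the same average over the design
as over the sphere. -/
noncomputable def designWeight : DesignIndex → ℝ
  | .inl _ => 1 / 15
  | .inr _ => 3 / 40

lemma designWeight_nonneg (l : DesignIndex) : 0 ≤ designWeight l := by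
  rcases l with _ | _ <;> norm_num [designWeight]

lemma designPoint_dotProduct_self (l : DesignIndex) : designPoint l ⬝ᵥ designPoint l = 1 := by
  have h : (√3 : ℝ)⁻¹ * (√3)⁻¹ = 1 / 3 := by
    rw [← mul_inv, Real.mul_self_sqrt (by norm_num)]; norm_num
  rcases l with ⟨i, b⟩ | ⟨a, b, c⟩
  · cases b <;> simp [designPoint, boolSign]
  · cases a <;> cases b <;> cases c <;>
      simp [designPoint, boolSign, dotProduct, Fin.sum_univ_three, h] <;> norm_num

lemma sum_designWeight : ∑ l, designWeight l = 1 := by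
  simp [designWeight, Fintype.sum_sum_type]
  norm_num

lemma sum_designWeight_mul_affine (e : ℝ) (v : Fin 3 → ℝ) :
    ∑ l, designWeight l * (e + v ⬝ᵥ designPoint l) = e := by
  simp only [Fintype.sum_sum_type, Fintype.sum_prod_type, Fintype.sum_bool, Fin.sum_univ_three,
    designWeight, designPoint, boolSign, dotProduct]
  simp
  ring

/-- Exactness of the design in degree at most four: the zonal harmonics of degree two and three are
orthogonal to the affine functions, and `n i * n j` averages to `δ i j / 3`. -/
lemma sum_designWeight_mul_harmonics (α β γ δ e : ℝ) (m v : Fin 3 → ℝ) :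
    ∑ l, designWeight l * ((α + β * (m ⬝ᵥ designPoint l)
        + γ * (3 * (m ⬝ᵥ designPoint l) ^ 2 - m ⬝ᵥ m)
        - δ * (5 * (m ⬝ᵥ designPoint l) ^ 3 - 3 * (m ⬝ᵥ m) * (m ⬝ᵥ designPoint l)))
        * (e + v ⬝ᵥ designPoint l)) = α * e + β / 3 * (m ⬝ᵥ v) := by
  have h2 : (√3 : ℝ)⁻¹ ^ 2 = 1 / 3 := by
    rw [inv_pow, Real.sq_sqrt (by norm_num)]; norm_num
  have h4 : (√3 : ℝ)⁻¹ ^ 4 = 1 / 9 := by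
    rw [show 4 = 2 * 2 from rfl, pow_mul, h2]; norm_num
  simp only [Fintype.sum_sum_type, Fintype.sum_prod_type, Fintype.sum_bool, Fin.sum_univ_three,
    designWeight, designPoint, boolSign, dotProduct]
  simp only [Pi.single_apply, Pi.smul_apply, smul_eq_mul, Matrix.cons_val]
  generalize (√3 : ℝ)⁻¹ = c at *
  simp
  ring_nf
  simp only [h2, h4]
  ring

/-- The qubit correlations of an isotropic state of visibility `11 / 30` are reproduced by a local
model whose hidden variable ranges over the design. -/
lemma sum_completedResponse_mul_qubitProb {κ : Type*} [Fintype κ]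
    {E : κ → Matrix (Fin 2) (Fin 2) ℂ} (hE : ∑ k, E k = 1) (k : κ)
    (F : Matrix (Fin 2) (Fin 2) ℂ) :
    ∑ l, designWeight l * (completedResponse E k (designPoint l) * qubitProb F (designPoint l)) =
      blochScalar (E k) * blochScalar F + 11 / 30 * (blochVector (E k) ⬝ᵥ blochVector F) := by
  have hb : ∀ j, ∑ l, designWeight l *
      (biasedResponse (E j) (designPoint l) * qubitProb F (designPoint l)) =
      5 / 6 * (blochScalar (E j) * blochScalar F)
        + 11 / 30 * (blochVector (E j) ⬝ᵥ blochVector F) := fun j => by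
    simp only [biasedResponse, qubitProb, sum_designWeight_mul_harmonics]
    ring
  have hs : ∑ j, ∑ l, designWeight l *
      (biasedResponse (E j) (designPoint l) * qubitProb F (designPoint l)) =
      5 / 6 * blochScalar F := by
    simp only [hb, Finset.sum_add_distrib, ← Finset.mul_sum, ← Finset.sum_mul,
      sum_blochScalar hE, ← sum_dotProduct, sum_blochVector hE, zero_dotProduct]
    ring
  have h1 := sum_designWeight_mul_affine (blochScalar F) (blochVector F)
  calc _ = ∑ l, designWeight l *
          (biasedResponse (E k) (designPoint l) * qubitProb F (designPoint l))
        + blochScalar (E k) * (∑ l, designWeight l * qubitProb F (designPoint l)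
          - ∑ j, ∑ l, designWeight l *
            (biasedResponse (E j) (designPoint l) * qubitProb F (designPoint l))) := by
        rw [Finset.sum_comm, ← Finset.sum_sub_distrib, Finset.mul_sum, ← Finset.sum_add_distrib]
        refine Finset.sum_congr rfl fun l _ => ?_
        rw [← Finset.mul_sum, ← Finset.sum_mul, completedResponse]
        ring
    _ = _ := by
        rw [hs, hb]
        simp only [qubitProb, h1]
        ring

/-! ### Effects of groups of parties -/

/-- The compression of the product effect of the parties in `B` to the span of the vectors
`|i⟩ ⊗ ⋯ ⊗ |i⟩`: the entrywise product of the effects of the parties. -/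
def groupEffect {N d : ℕ} {B : Finset (Fin N)} (M : B → POVM d)
    (a : (i : B) → (M i).Outcome) : Matrix (Fin d) (Fin d) ℂ :=
  Matrix.of fun i j => ∏ t, (M t).effect (a t) i j

/-- The Schur product theorem for finitely many factors. -/
lemma posSemidef_prod_entries {κ ι : Type*} [Fintype κ] (s : Finset ι) (f : ι → Matrix κ κ ℂ)
    (hf : ∀ t, (f t).PosSemidef) :
    (Matrix.of fun i j => ∏ t ∈ s, f t i j : Matrix κ κ ℂ).PosSemidef := by
  classical
  induction s using Finset.induction_on with
  | empty =>
    convert Matrix.posSemidef_vecMulVec_self_star (fun _ : κ => (1 : ℂ)) using 1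
    ext i j
    simp [Matrix.vecMulVec_apply]
  | insert t s ht ih =>
    have h : (Matrix.of fun i j => ∏ r ∈ insert t s, f r i j) =
        (f t).hadamard (Matrix.of fun i j => ∏ r ∈ s, f r i j) := by
      ext i j
      simp [ht]
    rw [h]
    exact (hf t).hadamard ih

section GroupEffect

variable {N d : ℕ} {B : Finset (Fin N)}

lemma groupEffect_posSemidef (M : B → POVM d) (a : (i : B) → (M i).Outcome) :
    (groupEffect M a).PosSemidef :=
  posSemidef_prod_entries Finset.univ (fun t => (M t).effect (a t)) fun t => (M t).posSemidef _

lemma sum_groupEffect (hB : B.Nonempty) (M : B → POVM d) : ∑ a, groupEffect M a = 1 := by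
  have : Nonempty B := hB.to_subtype
  ext i j
  have h : ∀ t : B, ∑ a, (M t).effect a i j = (1 : Matrix (Fin d) (Fin d) ℂ) i j := fun t => by
    rw [← (M t).sum_effect, Matrix.sum_apply]
  have hp := Finset.prod_univ_sum (fun t : B => (Finset.univ : Finset (M t).Outcome))
    (fun t a => (M t).effect a i j)
  rw [Fintype.piFinset_univ] at hp
  simp only [Matrix.sum_apply, groupEffect, Matrix.of_apply]
  rw [← hp]
  simp only [h]
  rcases eq_or_ne i j with rfl | hij
  · simp
  · simp [hij, hB.ne_empty]

end GroupEffect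

/-! ### The state -/

/-- The multi-index with entry `i` for the parties in `A` and `j` for the other parties. -/
def splitIndex {N : ℕ} (A : Finset (Fin N)) (i j : Fin 2) : Fin N → Fin 2 :=
  fun t => if t ∈ A then i else j

/-- The unnormalized Greenberger-Horne-Zeilinger vector `|0 ⋯ 0⟩ + |1 ⋯ 1⟩`. -/
def ghzVector (N : ℕ) : (Fin N → Fin 2) → ℂ :=
  ∑ i, Pi.single (fun _ => i) 1

/-- The image of the two-qubit isotropic state of visibility `11 / 30` under the isometries that
copy the basis vectors of the two qubits to the parties in `A` and to the other parties. -/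
noncomputable def copiedIsotropicState {N : ℕ} (A : Finset (Fin N)) : Operator N 2 :=
  (11 / 60 : ℝ) • ketBra (ghzVector N) +
    (19 / 120 : ℝ) • ∑ i, ∑ j, ketBra (Pi.single (splitIndex A i j) 1)

lemma trace_mul_ketBra {N d : ℕ} (X : Operator N d) (u : (Fin N → Fin d) → ℂ) :
    (X * ketBra u).trace = (X.mulVec u) ⬝ᵥ star u := by
  rw [ketBra, Matrix.mul_vecMulVec, Matrix.trace_vecMulVec]

lemma trace_mul_copiedIsotropicState {N : ℕ} (A : Finset (Fin N)) (X : Operator N 2) :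
    (X * copiedIsotropicState A).trace =
      (11 / 60 : ℝ) * ∑ i, ∑ k, X (fun _ => i) (fun _ => k) +
      (19 / 120 : ℝ) * ∑ i, ∑ j, X (splitIndex A i j) (splitIndex A i j) := by
  have h1 : (X * ketBra (ghzVector N)).trace = ∑ i, ∑ k, X (fun _ => i) (fun _ => k) := by
    rw [trace_mul_ketBra, ghzVector, Matrix.mulVec_sum, star_sum, dotProduct_sum]
    simp
  have h2 : ∀ x, (X * ketBra (Pi.single x 1)).trace = X x x := fun x => by
    rw [trace_mul_ketBra]
    simp
  simp only [copiedIsotropicState, mul_add, Matrix.mul_smul, Matrix.trace_add, Matrix.trace_smul,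
    Matrix.mul_sum, Matrix.trace_sum, h1, h2, Complex.real_smul]

lemma isState_copiedIsotropicState {N : ℕ} (hN : 0 < N) (A : Finset (Fin N)) :
    IsState (copiedIsotropicState A) := by
  refine ⟨?_, ?_⟩
  · refine Matrix.PosSemidef.add (Matrix.PosSemidef.smul
      (Matrix.posSemidef_vecMulVec_self_star _) (by norm_num)) (Matrix.PosSemidef.smul
      (Matrix.posSemidef_sum _ fun i _ => Matrix.posSemidef_sum _ fun j _ =>
        Matrix.posSemidef_vecMulVec_self_star _) (by norm_num))
  · have h := trace_mul_copiedIsotropicState A 1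
    have : Nonempty (Fin N) := ⟨⟨0, hN⟩⟩
    rw [one_mul] at h
    rw [h]
    simp [Matrix.one_apply, funext_iff]
    norm_num

/-! ### Genuine multipartite entanglement -/

lemma trace_ketBra_ghzVector_mul_ketBra {N : ℕ} (Ψ : (Fin N → Fin 2) → ℂ) :
    (ketBra (ghzVector N) * ketBra Ψ).trace = (‖Ψ (fun _ => 0) + Ψ (fun _ => 1)‖ ^ 2 : ℝ) := by
  have h : star (ghzVector N) ⬝ᵥ Ψ = Ψ (fun _ => 0) + Ψ (fun _ => 1) := by
    simp [ghzVector]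
  have h' : ghzVector N ⬝ᵥ star Ψ = star (Ψ (fun _ => 0) + Ψ (fun _ => 1)) := by
    simp [ghzVector]
  rw [trace_mul_ketBra, ketBra, Matrix.vecMulVec_mulVec, h]
  rw [smul_dotProduct, h', op_smul_eq_mul, mul_comm]
  exact_mod_cast Complex.mul_conj' _

lemma trace_ketBra_ghzVector_mul_copiedIsotropicState {N : ℕ} {A : Finset (Fin N)} (hA : A.Nonempty)
    (hA' : Aᶜ.Nonempty) :
    (ketBra (ghzVector N) * copiedIsotropicState A).trace = (21 / 20 : ℝ) := by
  obtain ⟨s, hs⟩ := hA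
  obtain ⟨t, ht⟩ := hA'
  have hst (i j k : Fin 2) : (splitIndex A i j = fun _ => k) ↔ i = k ∧ j = k := by
    constructor
    · intro h
      exact ⟨by simpa [splitIndex, hs] using congrFun h s,
        by simpa [splitIndex, Finset.mem_compl.1 ht] using congrFun h t⟩
    · rintro ⟨rfl, rfl⟩
      ext
      simp [splitIndex]
  have : Nonempty (Fin N) := ⟨s⟩
  rw [trace_mul_copiedIsotropicState]
  simp [ketBra, Matrix.vecMulVec_apply, ghzVector, Pi.single_apply, hst, funext_iff]
  norm_num

lemma norm_sq_add_norm_sq_le_one {N : ℕ} {B : Finset (Fin N)} (hB : B.Nonempty)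
    {ψ : GroupVector 2 B} (hψ : IsPureState ψ) :
    ‖ψ fun _ => 0‖ ^ 2 + ‖ψ fun _ => 1‖ ^ 2 ≤ 1 := by
  classical
  have : Nonempty B := hB.to_subtype
  have hne : (fun _ : B => (0 : Fin 2)) ≠ fun _ => 1 := by simp [funext_iff]
  rw [← Finset.sum_pair (f := fun x => ‖ψ x‖ ^ 2) hne, ← hψ]
  exact Finset.sum_le_sum_of_subset_of_nonneg (Finset.subset_univ _) fun _ _ _ => by positivity

/-- The squared overlap of a product vector with the normalized Greenberger-Horne-Zeilinger vector is
at most `1 / 2`: two of the factors suffice for the Cauchy-Schwarz bound, and the others have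
amplitudes of modulus at most one. -/
lemma norm_productVector_add_le_one {N : ℕ}
    {S : Finpartition (Finset.univ : Finset (Fin N))} (hS : 2 ≤ S.parts.card)
    {ψ : (B : Finset (Fin N)) → GroupVector 2 B} (hψ : ∀ B ∈ S.parts, IsPureState (ψ B)) :
    ‖productVector S ψ (fun _ => 0) + productVector S ψ (fun _ => 1)‖ ≤ 1 := by
  obtain ⟨B, hB, C, hC, hBC⟩ := Finset.one_lt_card.1 hS
  have key : ∀ D ∈ S.parts, ‖ψ D fun _ => 0‖ ^ 2 + ‖ψ D fun _ => 1‖ ^ 2 ≤ 1 := fun D hD =>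
    norm_sq_add_norm_sq_le_one (S.nonempty_of_mem_parts hD) (hψ D hD)
  have bound (i : Fin 2) :
      ‖productVector S ψ fun _ => i‖ ≤ ‖ψ B fun _ => i‖ * ‖ψ C fun _ => i‖ := by
    have hC' : C ∈ S.parts.erase B := Finset.mem_erase.2 ⟨hBC.symm, hC⟩
    rw [productVector, norm_prod, ← Finset.mul_prod_erase _ _ hB,
      ← Finset.mul_prod_erase _ _ hC', ← mul_assoc]
    refine mul_le_of_le_one_right (by positivity)
      (Finset.prod_le_one (fun _ _ => norm_nonneg _) fun D hD => ?_)
    have hD := key D (Finset.mem_of_mem_erase (Finset.mem_of_mem_erase hD))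
    have h0 := norm_nonneg (ψ D fun _ => i)
    have h1 : ‖ψ D fun _ => i‖ ^ 2 ≤ 1 := by
      fin_cases i
      · exact le_trans (le_add_of_nonneg_right (by positivity)) hD
      · exact le_trans (le_add_of_nonneg_left (by positivity)) hD
    nlinarith
  have hb := key B hB
  have hc := key C hC
  calc _ ≤ _ := norm_add_le _ _
    _ ≤ _ := add_le_add (bound 0) (bound 1)
    _ ≤ 1 := by
      nlinarith [sq_nonneg (‖ψ B fun _ => 0‖ - ‖ψ C fun _ => 0‖),
        sq_nonneg (‖ψ B fun _ => 1‖ - ‖ψ C fun _ => 1‖)]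

lemma isGME_copiedIsotropicState {N : ℕ} {A : Finset (Fin N)} (hA : A.Nonempty)
    (hA' : Aᶜ.Nonempty) : IsGME (copiedIsotropicState A) := by
  rintro K hK ⟨n, p, q, ψ, hp, hp1, hq, hψ, hσ⟩
  have h := trace_ketBra_ghzVector_mul_copiedIsotropicState hA hA'
  rw [hσ] at h
  simp only [Matrix.mul_sum, Matrix.mul_smul, Matrix.trace_sum, Matrix.trace_smul,
    trace_ketBra_ghzVector_mul_ketBra, smul_eq_mul] at h
  norm_cast at h
  have hle : ∑ S ∈ kPartitions N K, p S * ∑ i, q S i *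
      ‖productVector S (ψ S i) (fun _ => 0) + productVector S (ψ S i) (fun _ => 1)‖ ^ 2 ≤ 1 := by
    rw [← hp1]
    refine Finset.sum_le_sum fun S hS => mul_le_of_le_one_right (hp S hS) ?_
    rw [← (hq S hS).2]
    refine Finset.sum_le_sum fun i _ => mul_le_of_le_one_right ((hq S hS).1 i) ?_
    refine pow_le_one₀ (norm_nonneg _) (norm_productVector_add_le_one ?_ (hψ S hS i))
    rwa [(Finset.mem_filter.1 hS).2]
  norm_num at h
  linarith

/-! ### The bilocal model -/

/-- The partition of the parties into `A` and its complement. -/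
def bipartition {N : ℕ} {A : Finset (Fin N)} (hA : A.Nonempty) (hA' : Aᶜ.Nonempty) :
    Finpartition (Finset.univ : Finset (Fin N)) :=
  (Finpartition.indiscrete (Finset.nonempty_iff_ne_empty.1 hA')).extend
    (Finset.nonempty_iff_ne_empty.1 hA) disjoint_compl_left
    (by rw [sup_comm, sup_compl_eq_top]; rfl)

instance : MeasurableSingletonClass DesignIndex where
  measurableSet_singleton
    | .inl x => by
      rw [← Set.image_singleton]
      exact (MeasurableSet.singleton x).inl_image
    | .inr x => by
      rw [← Set.image_singleton]
      exact (MeasurableSet.singleton x).inr_image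

/-- The distribution of the hidden variable on the design. -/
noncomputable def designMeasure : MeasureTheory.Measure DesignIndex :=
  ∑ l, ENNReal.ofReal (designWeight l) • MeasureTheory.Measure.dirac l

lemma isProbabilityMeasure_designMeasure : MeasureTheory.IsProbabilityMeasure designMeasure := by
  refine ⟨?_⟩
  simp [designMeasure, ← ENNReal.ofReal_sum_of_nonneg fun l _ => designWeight_nonneg l,
    sum_designWeight, -Fintype.sum_sum_type]

lemma integral_designMeasure (f : DesignIndex → ℝ) :
    ∫ l, f l ∂designMeasure = ∑ l, designWeight l * f l := by
  rw [designMeasure, MeasureTheory.integral_finsetSum_measure fun _ _ =>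
    (MeasureTheory.integrable_dirac (by simp)).smul_measure ENNReal.ofReal_ne_top]
  simp [MeasureTheory.integral_smul_measure, designWeight_nonneg, -Fintype.sum_sum_type]

lemma bornProb_copiedIsotropicState {N : ℕ} (A : Finset (Fin N)) (M : Fin N → POVM 2)
    (a : (i : Fin N) → (M i).Outcome) :
    bornProb (copiedIsotropicState A) M a =
      (11 / 60 : ℝ) * ∑ i, ∑ k, groupEffect (fun t : A => M t) (fun t => a t) i k *
        groupEffect (fun t : ↥Aᶜ => M t) (fun t => a t) i k +
      (19 / 120 : ℝ) * ∑ i, ∑ j, groupEffect (fun t : A => M t) (fun t => a t) i i *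
        groupEffect (fun t : ↥Aᶜ => M t) (fun t => a t) j j := by
  have hg (B : Finset (Fin N)) (i k : Fin 2) :
      groupEffect (fun t : B => M t) (fun t => a t) i k = ∏ t ∈ B, (M t).effect (a t) i k :=
    Finset.prod_coe_sort B fun t => (M t).effect (a t) i k
  have hs (i j : Fin 2) : ∏ t, (M t).effect (a t) (splitIndex A i j t) (splitIndex A i j t) =
      (∏ t ∈ A, (M t).effect (a t) i i) * ∏ t ∈ Aᶜ, (M t).effect (a t) j j := by
    rw [← Finset.prod_mul_prod_compl A]
    congr 1
    · exact Finset.prod_congr rfl fun t ht => by simp [splitIndex, ht]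
    · exact Finset.prod_congr rfl fun t ht => by simp [splitIndex, Finset.mem_compl.1 ht]
  rw [bornProb, trace_mul_copiedIsotropicState]
  simp only [productEffect, Matrix.of_apply, hg, hs, Finset.prod_mul_prod_compl]

lemma isotropic_expectation_eq {E F : Matrix (Fin 2) (Fin 2) ℂ} (hE : E.PosSemidef)
    (hF : F.PosSemidef) :
    (11 / 60 : ℝ) * ∑ i, ∑ k, E i k * F i k + (19 / 120 : ℝ) * ∑ i, ∑ j, E i i * F j j =
      ((blochScalar E * blochScalar F.transpose +
        11 / 30 * (blochVector E ⬝ᵥ blochVector F.transpose) : ℝ) : ℂ) := by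
  simp only [Fin.sum_univ_two, apply_one_zero_eq hE, apply_one_zero_eq hF, blochScalar,
    blochVector, dotProduct, Fin.sum_univ_three, Matrix.transpose_apply]
  apply Complex.ext
  · simp [im_apply_self_eq_zero hE, im_apply_self_eq_zero hF]
    ring
  · simp [im_apply_self_eq_zero hE, im_apply_self_eq_zero hF]
    ring

open Classical in
/-- The response functions of the model: the group `A` uses the completed biased response, every
other group acts as if it held the pure qubit state given by the hidden variable. The transpose
is that in the correlations `tr (E Fᵀ)` of the maximally entangled state. -/
noncomputable def groupResponse {N : ℕ} (A B : Finset (Fin N)) (M : B → POVM 2)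
    (a : (i : B) → (M i).Outcome) (l : DesignIndex) : ℝ :=
  if B = A then completedResponse (groupEffect M) a (designPoint l)
  else qubitProb (groupEffect M a).transpose (designPoint l)

section Response

variable {N : ℕ} (A : Finset (Fin N)) {B : Finset (Fin N)} (M : B → POVM 2)

lemma groupResponse_nonneg (hB : B.Nonempty) (a : (i : B) → (M i).Outcome) (l : DesignIndex) :
    0 ≤ groupResponse A B M a l := by
  unfold groupResponse
  split_ifs
  · exact completedResponse_nonneg (groupEffect_posSemidef M) (sum_groupEffect hB M)
      (designPoint_dotProduct_self l) a
  · exact qubitProb_nonneg (groupEffect_posSemidef M a).transpose (designPoint_dotProduct_self l)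

lemma sum_groupResponse (hB : B.Nonempty) (l : DesignIndex) :
    ∑ a, groupResponse A B M a l = 1 := by
  unfold groupResponse
  split_ifs
  · exact sum_completedResponse (sum_groupEffect hB M) _
  · refine sum_qubitProb ?_ _
    rw [← Matrix.transpose_sum, sum_groupEffect hB M, Matrix.transpose_one]

end Response

lemma bornProb_eq_integral_groupResponse {N : ℕ} {A : Finset (Fin N)} (hA : A.Nonempty)
    (M : Fin N → POVM 2) (a : (i : Fin N) → (M i).Outcome) :
    bornProb (copiedIsotropicState A) M a =
      (∫ l, groupResponse A A (fun i => M i) (fun i => a i) l *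
        groupResponse A Aᶜ (fun i => M i) (fun i => a i) l ∂designMeasure : ℝ) := by
  have hne : Aᶜ ≠ A := fun h => by
    obtain ⟨t, ht⟩ := hA
    exact Finset.mem_compl.1 (h.symm ▸ ht) ht
  rw [bornProb_copiedIsotropicState, integral_designMeasure, isotropic_expectation_eq
    (groupEffect_posSemidef _ _) (groupEffect_posSemidef _ _),
    ← sum_completedResponse_mul_qubitProb (sum_groupEffect hA _)]
  simp only [groupResponse, if_true, if_neg hne]

open Classical in
lemma isBilocal_copiedIsotropicState {N : ℕ} {A : Finset (Fin N)} (hA : A.Nonempty)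
    (hA' : Aᶜ.Nonempty) : IsBilocal (copiedIsotropicState A) := by
  have hne : A ≠ Aᶜ := fun h => by
    obtain ⟨t, ht⟩ := hA
    exact Finset.mem_compl.1 (h ▸ ht) ht
  have hparts : (bipartition hA hA').parts = {A, Aᶜ} := rfl
  have hmem : bipartition hA hA' ∈ kPartitions N 2 := by
    simp [kPartitions, hparts, Finset.card_pair hne]
  refine ⟨{
    Hidden := DesignIndex
    weight := fun S => if S = bipartition hA hA' then 1 else 0
    weight_nonneg := fun S _ => by split_ifs <;> norm_num
    sum_weight := by simp [hmem]
    ω := fun _ => designMeasure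
    isProbabilityMeasure := fun _ _ => isProbabilityMeasure_designMeasure
    response := fun _ => groupResponse A
    response_measurable := fun _ _ _ _ _ _ => measurable_of_finite _
    response_nonneg := fun S _ B hB M a l =>
      groupResponse_nonneg A M (S.nonempty_of_mem_parts hB) a l
    sum_response := fun S _ B hB M l => sum_groupResponse A M (S.nonempty_of_mem_parts hB) l
    bornProb_eq := fun M a => ?_ }⟩
  rw [bornProb_eq_integral_groupResponse hA]
  simp only [ite_mul, one_mul, zero_mul, Finset.sum_ite_eq', hmem, if_true, hparts,
    Finset.prod_pair hne]

end MultipartiteLocality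

open MultipartiteLocality in
theorem mainTheorem1 (N : ℕ) (hN : 2 ≤ N) :
    (∃ (d : ℕ) (σ : Operator N d), IsState σ ∧ IsGME σ ∧ IsBilocal σ) ∧
    ¬ (∀ (d : ℕ) (σ : Operator N d), IsState σ → (IsGME σ ↔ IsGMN σ)) := by
  let A : Finset (Fin N) := {⟨0, by omega⟩}
  have hA : A.Nonempty := Finset.singleton_nonempty _
  have hA' : Aᶜ.Nonempty := ⟨⟨1, by omega⟩, by simp [A]⟩
  have hσ := isState_copiedIsotropicState (by omega) A
  have hE := isGME_copiedIsotropicState hA hA'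
  have hL := isBilocal_copiedIsotropicState hA hA'
  exact ⟨⟨2, _, hσ, hE, hL⟩, fun h => (h 2 _ hσ).1 hE hL⟩
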